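/- Let $e, d \ge 0$ be integers and let $C \in \mathbb{C}[x,y,z]$ be a homogeneous polynomial of degree $e$ with no multiple factors and with no component at infinity (that is, $z \nmid C$). In case $d < e-2$ assume moreover that $C_x$ and $C_y$ have no common factor, i.e. that the scheme $\{C_x = C_y = 0\} \subset \mathbb{P}^2$ of critical points of the Hamiltonian vector field of $C$ is finite. Let $M_C = (C_x, C_y, C)$ be the Darboux matrix of $C$, where $C_x, C_y$ are the partial derivatives, and let $$\mathcal{V}_C(d) = (\ker M_C)_d = \{ (Q,-P,-K) : C_x Q - C_y P = C K \},$$ where $P, Q \in \mathbb{C}[x,y,z]$ are homogeneous of degree $d$ and $K$ is homogeneous of degree $d-1$ (only $K=0$ if $d=0$); this is the space of differential forms $P\,dx + Q\,dy$ of degree $d$ that admit $C$ as an integral curve, with cofactor $K\,dx\,dy$. Let $X \subset \mathbb{P}^2$ be the scheme defined by the vanishing of $M_C$, i.e. by $C_x = C_y = C = 0$. Then $X$ is a finite scheme over $\mathbb{C}$, and with $\deg X = \dim_{\mathbb{C}} \Gamma(X, \mathcal{O}_X)$, $$\dim_{\mathbb{C}} \mathcal{V}_C(d) \;\ge\; \delta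 := \binom{d-e+3}{2} + \binom{d+1}{2} - (e-1)^2 + \deg X,$$ where the first summand is read as $0$ if $e > d+1$. The number $\delta$ is called the expected dimension of the space of differential forms of degree $d$ with integral curve $C$. -/

import Mathlib

open MvPolynomial CategoryTheory AlgebraicGeometry

noncomputable section

attribute [local instance] MvPolynomial.gradedAlgebra

namespace PlaneCurve

/-! ### The grading on the quotient of a graded algebra by a homogeneous ideal -/

section Quotient

variable {K A : Type} [Field K] [CommRing A] [Algebra K A]
  (𝒜 : ℕ → Submodule K A) [GradedAlgebra 𝒜] (I : HomogeneousIdeal 𝒜)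

/-- The degree `n` part of `A ⧸ I`: the image of the degree `n` part of `A`. -/
def quotientGrading (n : ℕ) : Submodule K (A ⧸ I.toIdeal) :=
  (𝒜 n).map (Ideal.Quotient.mkₐ K I.toIdeal).toLinearMap

instance quotientGrading.gradedMonoid : SetLike.GradedMonoid (quotientGrading 𝒜 I) where
  one_mem := ⟨1, SetLike.GradedOne.one_mem, map_one (Ideal.Quotient.mkₐ K I.toIdeal)⟩
  mul_mem := by
    rintro i j _ _ ⟨a, ha, rfl⟩ ⟨b, hb, rfl⟩
    exact ⟨a * b, SetLike.GradedMul.mul_mem ha hb, map_mul (Ideal.Quotient.mkₐ K I.toIdeal) a b⟩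

theorem quotientGrading.isInternal : DirectSum.IsInternal (quotientGrading 𝒜 I) := by
  have hint := DirectSum.Decomposition.isInternal 𝒜
  apply DirectSum.isInternal_submodule_of_iSupIndep_of_iSup_eq_top
  · intro i
    rw [Submodule.disjoint_def]
    rintro _ ⟨a, ha, rfl⟩ hx
    have : (⨆ j, ⨆ (_ : j ≠ i), quotientGrading 𝒜 I j)
        = (⨆ j, ⨆ (_ : j ≠ i), 𝒜 j).map (Ideal.Quotient.mkₐ K I.toIdeal).toLinearMap := by
      simp only [Submodule.map_iSup, quotientGrading]
    rw [this] at hx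
    obtain ⟨b, hb, hab⟩ := hx
    have hb0 : GradedRing.proj 𝒜 i b = 0 := by
      have hle : (⨆ j, ⨆ (_ : j ≠ i), 𝒜 j)
          ≤ LinearMap.ker (GradedAlgebra.proj 𝒜 i) := by
        refine iSup₂_le fun j hj y hy => ?_
        rw [LinearMap.mem_ker, GradedAlgebra.proj_apply]
        exact DirectSum.decompose_of_mem_ne 𝒜 hy hj
      exact hle hb
    have hsub : b - a ∈ I.toIdeal := Ideal.Quotient.eq.mp hab
    have h2 := I.isHomogeneous i hsub
    rw [DirectSum.decompose_sub, DirectSum.sub_apply, AddSubgroupClass.coe_sub,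
      DirectSum.decompose_of_mem_same 𝒜 ha] at h2
    rw [GradedRing.proj_apply] at hb0
    rw [hb0, zero_sub, neg_mem_iff] at h2
    exact Ideal.Quotient.eq_zero_iff_mem.mpr h2
  · have : (⨆ i, quotientGrading 𝒜 I i)
        = (⨆ i, 𝒜 i).map (Ideal.Quotient.mkₐ K I.toIdeal).toLinearMap := by
      simp only [Submodule.map_iSup, quotientGrading]
    rw [this, hint.submodule_iSup_eq_top, Submodule.map_top, LinearMap.range_eq_top]
    exact Ideal.Quotient.mkₐ_surjective K I.toIdeal

instance quotientGrading.gradedAlgebra : GradedAlgebra (quotientGrading 𝒜 I) :=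
  (quotientGrading.isInternal 𝒜 I).gradedAlgebra

/-- The closed subscheme of `Proj A` defined by the homogeneous ideal `I`, i.e. `Proj (A ⧸ I)`. -/
def projSubscheme : Scheme :=
  Proj (quotientGrading 𝒜 I)

/-- The structure morphism of `Proj (A ⧸ I)` to the base field. -/
def projSubschemeStructure : projSubscheme 𝒜 I ⟶ Spec (CommRingCat.of K) :=
  Proj.toSpecZero (quotientGrading 𝒜 I) ≫
    Spec.map (CommRingCat.ofHom (algebraMap K (quotientGrading 𝒜 I 0)))

end Quotient

/-- The degree of a finite scheme `f : X ⟶ Spec K` over a field `K`: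
the `K`-dimension of the ring `Γ(X, 𝒪_X)` of global functions, which is a `K`-algebra through `f`. -/
def finiteDegree {K : Type} [Field K] {X : Scheme.{0}} (f : X ⟶ Spec (CommRingCat.of K)) : ℕ :=
  letI : Algebra K Γ(X, ⊤) :=
    ((Scheme.ΓSpecIso (CommRingCat.of K)).inv ≫ f.appTop).hom.toAlgebra
  Module.finrank K Γ(X, ⊤)

/-! ### Plane curves.  The coordinates `x, y, z` are `X 0, X 1, X 2`. -/

/-- The Darboux matrix `M_C = (C_x, C_y, C)` of one curve. -/
def darbouxMatrix (C : MvPolynomial (Fin 3) ℂ) :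
    Matrix (Fin 1) (Fin 3) (MvPolynomial (Fin 3) ℂ) :=
  !![pderiv 0 C, pderiv 1 C, C]

/-- The homogeneous ideal `(C_x, C_y, C)` generated by the entries of the Darboux matrix. -/
def darbouxIdeal (C : MvPolynomial (Fin 3) ℂ) {e : ℕ} (hC : C.IsHomogeneous e) :
    HomogeneousIdeal (homogeneousSubmodule (Fin 3) ℂ) where
  toSubmodule := Ideal.span (Set.range fun j => darbouxMatrix C 0 j)
  is_homogeneous' := by
    apply Ideal.homogeneous_span
    rintro _ ⟨j, rfl⟩
    fin_cases j
    · exact ⟨e - 1, hC.pderiv⟩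
    · exact ⟨e - 1, hC.pderiv⟩
    · exact ⟨e, hC⟩

/-- The scheme `X ⊆ ℙ²` over `ℂ` defined by the vanishing of the Darboux matrix, given through its
structure morphism `X ⟶ Spec ℂ`. -/
def darbouxScheme (C : MvPolynomial (Fin 3) ℂ) {e : ℕ} (hC : C.IsHomogeneous e) :
    projSubscheme (homogeneousSubmodule (Fin 3) ℂ) (darbouxIdeal C hC) ⟶
      Spec (CommRingCat.of ℂ) :=
  projSubschemeStructure (homogeneousSubmodule (Fin 3) ℂ) (darbouxIdeal C hC)

/-- Forms of degree `d - 1` in `x, y, z`, where the only form of degree `-1` is `0`. -/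
def predForms : ℕ → Submodule ℂ (MvPolynomial (Fin 3) ℂ)
  | 0 => ⊥
  | n + 1 => homogeneousSubmodule (Fin 3) ℂ n

/-- The space `𝒱_C(d) = (ker M_C)_d`.  The vector `(Q, -P, -K)` stands for the differential form
`P dx + Q dy` of degree `d` with integral curve `C` and cofactor `K dx dy`, where `P, Q` are
homogeneous of degree `d` and `K` is homogeneous of degree `d - 1`. -/
def integralForms (C : MvPolynomial (Fin 3) ℂ) (d : ℕ) :
    Submodule ℂ (Fin 3 → MvPolynomial (Fin 3) ℂ) :=
  (LinearMap.ker (darbouxMatrix C).mulVecLin).restrictScalars ℂ ⊓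
    Submodule.pi Set.univ
      ![homogeneousSubmodule (Fin 3) ℂ d, homogeneousSubmodule (Fin 3) ℂ d, predForms d]

end PlaneCurve

end

noncomputable section

attribute [local instance] MvPolynomial.gradedAlgebra

namespace PlaneCurve

/-! Write S = ℂ[x,y,z] and I = (C_x, C_y, C). The space 𝒱_C(d) is the kernel of the linear map S_d²
⊕ S_{d-1} → I_{d+e-1} given by M_C, so rank-nullity reduces the claim to an upper bound for dim I_m
with m = d+e-1.

The bound compares I with a complete intersection J = (F₁, F₂) ⊆ I of degrees a, b. A linear form l
that is regular modulo J exists because the irrelevant ideal is not associated to S/J.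
Multiplication by l^k embeds I_m/J_m into I_N/J_N for N = m+k. For large N, dim (S/J)_N = ab and l
acts bijectively from degree N to N+1. Hence X lies in the chart l ≠ 0, and (S/I)_N maps onto its
coordinate ring, which gives finiteness and deg X ≤ dim (S/I)_N. Together: dim I_m + deg X ≤ dim J_m
+ ab (`isFinite_and_finrank_add_finiteDegree_le`).

It remains to choose J. If d < e-2, take C_x and C_y, coprime by hypothesis. If d ≥ e-2 and e > 0,
they may share a factor; take a nonzero partial derivative and a general form of degree e in I,
coprime to it because I has no common component. Then m ≥ a+b-2, so dim J_m + ab is simply dim S_m.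
If e = 0, I is the unit ideal. -/

theorem finiteDegree_eq_finrank {K A : Type} [Field K] [CommRing A] {X : Scheme.{0}}
    (f : X ⟶ Spec (CommRingCat.of K)) (g : Spec (CommRingCat.of A) ⟶ X) [IsIso g] (φ : K →+* A)
    (hg : g ≫ f = Spec.map (CommRingCat.ofHom φ)) :
    finiteDegree f = @Module.finrank K A _ _ φ.toAlgebra.toModule := by
  let i₁ : Algebra K Γ(X, ⊤) :=
    ((Scheme.ΓSpecIso (CommRingCat.of K)).inv ≫ f.appTop).hom.toAlgebra
  let i₂ : Algebra K A := φ.toAlgebra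
  have hiso : IsIso g.appTop := inferInstanceAs (IsIso (g.app ⊤))
  have hcomp : ((Scheme.ΓSpecIso (CommRingCat.of K)).inv ≫ f.appTop) ≫
      (asIso g.appTop ≪≫ Scheme.ΓSpecIso (CommRingCat.of A)).hom = CommRingCat.ofHom φ := by
    simp only [Iso.trans_hom, asIso_hom, Category.assoc]
    rw [← Scheme.Hom.comp_appTop_assoc, hg, Iso.inv_comp_eq]
    exact Scheme.ΓSpecIso_naturality _
  let E : Γ(X, ⊤) ≃ₐ[K] A := AlgEquiv.ofRingEquiv
    (f := (asIso g.appTop ≪≫ Scheme.ΓSpecIso (CommRingCat.of A)).commRingCatIsoToRingEquiv)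
    (fun r => congr($hcomp r))
  exact E.toLinearEquiv.finrank_eq

/-! ### Proj of a graded algebra whose large degrees are multiples of one linear element -/

section Proj

variable {K B : Type} [Field K] [CommRing B] [Algebra K B] (ℬ : ℕ → Submodule K B)
  [GradedAlgebra ℬ]

/-- The structure morphism of `Proj ℬ` to the base field. -/
def projStructure : Proj ℬ ⟶ Spec (CommRingCat.of K) :=
  Proj.toSpecZero ℬ ≫ Spec.map (CommRingCat.ofHom (algebraMap K (ℬ 0)))

variable {ℬ} {l : B} (hl : l ∈ ℬ 1) {n₀ : ℕ}
  (h : ∀ n, n₀ ≤ n → ∀ a ∈ ℬ (n + 1), ∃ b ∈ ℬ n, a = l * b)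

omit [GradedAlgebra ℬ] in
include h in
theorem exists_eq_pow_mul {n : ℕ} (hn : n₀ ≤ n) (k : ℕ) :
    ∀ a ∈ ℬ (n + k), ∃ b ∈ ℬ n, a = l ^ k * b := by
  induction k with
  | zero => exact fun a ha => ⟨a, ha, by simp⟩
  | succ k ih =>
    intro a ha
    obtain ⟨b, hb, rfl⟩ := h (n + k) (by omega) a ha
    obtain ⟨c, hc, rfl⟩ := ih b hb
    exact ⟨c, hc, by ring⟩

-- A relevant prime containing `l` would contain a power of every element of positive degree, since
-- high degrees consist of multiples of `l`; it would then contain the irrelevant ideal.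
open scoped Classical in
include h in
theorem basicOpen_eq_top : Proj.basicOpen ℬ l = ⊤ := by
  refine top_le_iff.mp fun x _ => ?_
  rw [Proj.mem_basicOpen]
  intro hx
  refine x.not_irrelevant_le fun a ha => ?_
  have hprime := x.isPrime
  have key : ∀ i, 0 < i → ∀ c ∈ ℬ i, c ∈ x.asHomogeneousIdeal := by
    intro i hi c hc
    -- The exponent n₀ + 1 puts the power in degree greater than n₀, so that at least one factor `l`
    -- splits off.
    have hmem : c ^ (n₀ + 1) ∈ ℬ (n₀ + ((n₀ + 1) * i - n₀)) := by
      have := SetLike.pow_mem_graded (n₀ + 1) hc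
      rwa [smul_eq_mul, show (n₀ + 1) * i = n₀ + ((n₀ + 1) * i - n₀) by
        have : n₀ + 1 ≤ (n₀ + 1) * i := Nat.le_mul_of_pos_right _ hi
        omega] at this
    obtain ⟨b, -, hb⟩ := exists_eq_pow_mul h le_rfl _ _ hmem
    have hpos : (n₀ + 1) * i - n₀ ≠ 0 := by
      have : n₀ + 1 ≤ (n₀ + 1) * i := Nat.le_mul_of_pos_right _ hi
      omega
    have h2 : c ^ (n₀ + 1) ∈ x.asHomogeneousIdeal.toIdeal := by
      rw [hb]
      exact Ideal.mul_mem_right _ _ (Ideal.pow_mem_of_mem _ hx _ (Nat.pos_of_ne_zero hpos))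
    exact hprime.mem_of_pow_mem _ h2
  have hsum := DirectSum.sum_support_decompose ℬ a
  change a ∈ x.asHomogeneousIdeal.toIdeal
  rw [← hsum]
  refine Ideal.sum_mem _ fun i _ => ?_
  rcases Nat.eq_zero_or_pos i with rfl | hi
  · have : (DirectSum.decompose ℬ a 0 : B) = 0 := by
      rw [← GradedRing.proj_apply]
      exact (HomogeneousIdeal.mem_irrelevant_iff ℬ a).mp ha
    rw [this]
    exact zero_mem _
  · exact key i hi _ (SetLike.coe_mem _)

-- Any denominator l^n can be changed to the fixed l^N: divide the numerator by a power of `l` if n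
-- ≥ N, multiply it if n ≤ N.
open HomogeneousLocalization in
include h in
theorem exists_away_mk_eq {N : ℕ} (hN : n₀ ≤ N) (z : Away ℬ l) :
    ∃ b, ∃ hb : b ∈ ℬ (N • 1), Away.mk ℬ hl N b hb = z := by
  obtain ⟨n, a, ha, rfl⟩ := Away.mk_surjective ℬ hl z
  rcases le_total N n with hn | hn
  · obtain ⟨k, rfl⟩ := Nat.exists_eq_add_of_le hn
    have ha' : a ∈ ℬ (N + k) := by simpa using ha
    obtain ⟨b, hb, rfl⟩ := exists_eq_pow_mul h hN k a ha'
    refine ⟨b, by simpa using hb, ?_⟩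
    apply HomogeneousLocalization.val_injective
    rw [Away.val_mk, Away.val_mk, Localization.mk_eq_mk_iff, Localization.r_iff_exists]
    exact ⟨1, by simp only [OneMemClass.coe_one, one_mul]; ring⟩
  · obtain ⟨k, rfl⟩ := Nat.exists_eq_add_of_le hn
    have hmem : l ^ k * a ∈ ℬ ((n + k) • 1) := by
      have := SetLike.mul_mem_graded (SetLike.pow_mem_graded k hl) ha
      simpa [add_comm] using this
    refine ⟨l ^ k * a, hmem, ?_⟩
    apply HomogeneousLocalization.val_injective
    rw [Away.val_mk, Away.val_mk, Localization.mk_eq_mk_iff, Localization.r_iff_exists]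
    exact ⟨1, by simp only [OneMemClass.coe_one, one_mul]; ring⟩

-- Proj is the single affine chart of `l`, and b ↦ b / l^N maps ℬ_N onto its coordinate ring. Only
-- an upper bound for the degree is needed, so the kernel of this map is irrelevant.
open HomogeneousLocalization in
include hl h in
theorem isFinite_projStructure_and_finiteDegree_le (hfin : ∀ n, Module.Finite K (ℬ n)) {N : ℕ}
    (hN : n₀ ≤ N) : IsFinite (projStructure ℬ) ∧
      finiteDegree (projStructure ℬ) ≤ Module.finrank K (ℬ N) := by
  let φ : K →+* Away ℬ l := (fromZeroRingHom ℬ _).comp (algebraMap K (ℬ 0))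
  let i₁ : Algebra K (Away ℬ l) := φ.toAlgebra
  let ψ : ℬ (N • 1) →ₗ[K] Away ℬ l :=
    { toFun := fun b => Away.mk ℬ hl N b b.2
      map_add' := fun a b => by
        apply HomogeneousLocalization.val_injective
        rw [HomogeneousLocalization.val_add, Away.val_mk, Away.val_mk, Away.val_mk,
          Localization.add_mk_self, Submodule.coe_add]
      map_smul' := fun c b => by
        apply HomogeneousLocalization.val_injective
        rw [RingHom.id_apply, Algebra.smul_def (A := Away ℬ l), HomogeneousLocalization.val_mul,
          Away.val_mk, Away.val_mk]
        have : (algebraMap K (Away ℬ l) c).val = Localization.mk (algebraMap K B c) 1 := rfl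
        rw [this, Localization.mk_mul, one_mul]
        congr 1
        simp [Algebra.smul_def] }
  have hψ : Function.Surjective ψ := fun z => by
    obtain ⟨b, hb, hz⟩ := exists_away_mk_eq hl h hN z
    exact ⟨⟨b, hb⟩, hz⟩
  have hrange := Proj.opensRange_awayι ℬ l hl one_pos
  rw [basicOpen_eq_top h] at hrange
  have : IsIso (Proj.awayι ℬ l hl one_pos) := by
    have : Epi (Proj.awayι ℬ l hl one_pos).base := by
      rw [TopCat.epi_iff_surjective]
      intro x
      have : x ∈ (Proj.awayι ℬ l hl one_pos).opensRange := by rw [hrange]; trivial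
      exact this
    exact IsOpenImmersion.isIso _
  have hcomp : Proj.awayι ℬ l hl one_pos ≫ projStructure ℬ = Spec.map (CommRingCat.ofHom φ) := by
    rw [projStructure, Proj.awayι_toSpecZero_assoc, ← Spec.map_comp]
    rfl
  have hf : Module.Finite K (Away ℬ l) := Module.Finite.of_surjective ψ hψ
  constructor
  · rw [← IsIso.eq_inv_comp] at hcomp
    have : IsFinite (Spec.map (CommRingCat.ofHom φ)) := (IsFinite.SpecMap_iff _).mpr hf
    rw [hcomp]
    infer_instance
  · rw [finiteDegree_eq_finrank _ _ φ hcomp]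
    have := LinearMap.finrank_le_finrank_of_surjective hψ
    rwa [smul_eq_mul, mul_one] at this

end Proj
/-! ### Forms of integer degree -/

/-- The forms of integer degree `m` in `x, y, z`; there are no nonzero ones if `m < 0`. -/
def intForms (m : ℤ) : Submodule ℂ (MvPolynomial (Fin 3) ℂ) where
  carrier := {p | ∀ d, coeff d p ≠ 0 → (d.degree : ℤ) = m}
  zero_mem' := fun d hd => absurd (coeff_zero d) hd
  add_mem' := fun {p q} hp hq d hd => by
    by_cases h : coeff d p = 0
    · exact hq d fun h' => hd (by rw [coeff_add, h, h', add_zero])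
    · exact hp d h
  smul_mem' := fun c p hp d hd => hp d fun h => hd (by rw [coeff_smul, h, smul_zero])

theorem mem_intForms {m : ℤ} {p : MvPolynomial (Fin 3) ℂ} :
    p ∈ intForms m ↔ ∀ d, coeff d p ≠ 0 → (d.degree : ℤ) = m := Iff.rfl

theorem intForms_natCast (n : ℕ) : intForms n = homogeneousSubmodule (Fin 3) ℂ n := by
  ext p
  rw [mem_intForms, mem_homogeneousSubmodule, IsHomogeneous, IsWeightedHomogeneous]
  simp only [Nat.cast_inj, Finsupp.degree_eq_weight_one]
  rfl

theorem intForms_of_neg {m : ℤ} (hm : m < 0) : intForms m = ⊥ := by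
  rw [eq_bot_iff]
  intro p hp
  ext d
  by_contra h
  have := hp d h
  omega

/-- The component of integer degree `m` of a polynomial. -/
def intComponent (m : ℤ) : MvPolynomial (Fin 3) ℂ →ₗ[ℂ] MvPolynomial (Fin 3) ℂ :=
  if 0 ≤ m then homogeneousComponent m.toNat else 0

theorem coeff_intComponent (m : ℤ) (d : Fin 3 →₀ ℕ) (p : MvPolynomial (Fin 3) ℂ) :
    coeff d (intComponent m p) = if (d.degree : ℤ) = m then coeff d p else 0 := by
  rw [intComponent]
  split_ifs with h1 h2 h2
  · rw [coeff_homogeneousComponent, if_pos (by omega)]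
  · rw [coeff_homogeneousComponent, if_neg (by omega)]
  · omega
  · simp

theorem intComponent_mem (m : ℤ) (p : MvPolynomial (Fin 3) ℂ) : intComponent m p ∈ intForms m := by
  intro d hd
  rw [coeff_intComponent] at hd
  by_contra h
  exact hd (if_neg h)

theorem intComponent_eq_self {m : ℤ} {p : MvPolynomial (Fin 3) ℂ} (hp : p ∈ intForms m) :
    intComponent m p = p := by
  ext d
  rw [coeff_intComponent]
  split_ifs with h
  · rfl
  · by_contra h'
    exact h (hp d (Ne.symm h'))

theorem intComponent_mul {F : MvPolynomial (Fin 3) ℂ} {a : ℤ} (hF : F ∈ intForms a) (m : ℤ)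
    (p : MvPolynomial (Fin 3) ℂ) : intComponent m (F * p) = F * intComponent (m - a) p := by
  ext d
  have key : ∀ x ∈ Finset.HasAntidiagonal.antidiagonal d, coeff x.1 F * coeff x.2 (intComponent (m - a) p) =
      if (d.degree : ℤ) = m then coeff x.1 F * coeff x.2 p else 0 := by
    intro x hx
    by_cases hxF : coeff x.1 F = 0
    · simp [hxF]
    · have h1 := hF x.1 hxF
      have h2 : (d.degree : ℤ) = x.1.degree + x.2.degree := by
        rw [← Finset.HasAntidiagonal.mem_antidiagonal.mp hx, map_add, Nat.cast_add]
      rw [coeff_intComponent, mul_ite, mul_zero]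
      exact if_congr (by omega) rfl rfl
  rw [coeff_intComponent, coeff_mul, coeff_mul, Finset.sum_congr rfl key]
  split_ifs <;> simp

theorem mul_mem_intForms {F p : MvPolynomial (Fin 3) ℂ} {a m : ℤ} (hF : F ∈ intForms a)
    (hp : p ∈ intForms (m - a)) : F * p ∈ intForms m := by
  have := intComponent_mem m (F * p)
  rwa [intComponent_mul hF, intComponent_eq_self hp] at this

instance finite_intForms (m : ℤ) : Module.Finite ℂ (intForms m) := by
  rcases lt_or_ge m 0 with h | h
  · rw [intForms_of_neg h]
    infer_instance
  · obtain ⟨n, rfl⟩ := Int.eq_ofNat_of_zero_le h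
    rw [intForms_natCast]
    exact Module.Finite.iff_fg.mpr (homogeneousSubmodule_fg (Fin 3) ℂ n)

theorem finrank_intForms_natCast (n : ℕ) :
    Module.finrank ℂ (intForms n) = (n + 2).choose 2 := by
  rw [intForms_natCast, homogeneousSubmodule_eq_finsupp_supported,
    (AddMonoidAlgebra.supportedEquivFinsupp {d : Fin 3 →₀ ℕ | d.degree = n}).finrank_eq]
  have hset : {d : Fin 3 →₀ ℕ | d.degree = n} =
      ((Finset.univ : Finset (Fin 3)).finsuppAntidiag n : Set (Fin 3 →₀ ℕ)) := by
    ext d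
    simp [Finset.mem_finsuppAntidiag, Finsupp.degree_eq_sum]
  rw [hset, Module.finrank_finsupp, Module.finrank_self, mul_one, ← Nat.card_eq_fintype_card,
    Nat.card_coe_set_eq, Set.ncard_coe_finset,
    Finset.card_finsuppAntidiag_nat_eq_choose, Finset.card_univ, Fintype.card_fin,
    show 3 + n - 1 = n + 2 by omega, Nat.choose_symm_add]

theorem two_mul_choose_two (n : ℕ) : 2 * ((n.choose 2 : ℕ) : ℤ) = n * (n - 1) := by
  rcases n with _ | n
  · simp
  · rw [Nat.choose_two_right]
    have h : 2 ∣ (n + 1) * (n + 1 - 1) := by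
      simpa [mul_comm] using (Nat.even_mul_succ_self n).two_dvd
    have h2 := Nat.mul_div_cancel' h
    have h3 : ((2 * ((n + 1) * (n + 1 - 1) / 2) : ℕ) : ℤ) = (((n + 1) * (n + 1 - 1) : ℕ) : ℤ) := by
      rw [h2]
    push_cast at h3 ⊢
    simpa using h3

/-- The polynomial (m+1)(m+2) vanishes at -1 and -2, so the dimension formula remains valid for
these two negative degrees. The extra range is what the numerical bounds below rely on. -/
theorem two_mul_finrank_intForms {m : ℤ} (hm : -2 ≤ m) :
    2 * (Module.finrank ℂ (intForms m) : ℤ) = (m + 1) * (m + 2) := by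
  rcases lt_or_ge m 0 with h | h
  · rw [intForms_of_neg h, finrank_bot]
    obtain rfl | rfl : m = -1 ∨ m = -2 := by omega
    all_goals norm_num
  · obtain ⟨n, rfl⟩ := Int.eq_ofNat_of_zero_le h
    rw [finrank_intForms_natCast, two_mul_choose_two]
    push_cast
    ring

/-! ### Homogeneous pieces of ideals -/

/-- The elements of an ideal that are forms of integer degree `m`. -/
def intPart (I : Ideal (MvPolynomial (Fin 3) ℂ)) (m : ℤ) :
    Submodule ℂ (MvPolynomial (Fin 3) ℂ) :=
  I.restrictScalars ℂ ⊓ intForms m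

theorem mem_intPart {I : Ideal (MvPolynomial (Fin 3) ℂ)} {m : ℤ} {p : MvPolynomial (Fin 3) ℂ} :
    p ∈ intPart I m ↔ p ∈ I ∧ p ∈ intForms m := Iff.rfl

theorem intPart_top (m : ℤ) : intPart ⊤ m = intForms m := by
  ext p
  simp [mem_intPart]

instance finite_intPart (I : Ideal (MvPolynomial (Fin 3) ℂ)) (m : ℤ) :
    Module.Finite ℂ (intPart I m) :=
  Submodule.finiteDimensional_of_le (inf_le_right : intPart I m ≤ intForms m)

theorem mulLeft_injective {F : MvPolynomial (Fin 3) ℂ} (hF : F ≠ 0) :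
    Function.Injective (LinearMap.mulLeft ℂ F) :=
  fun _ _ h => mul_left_cancel₀ hF h

theorem finrank_map_mulLeft {F : MvPolynomial (Fin 3) ℂ} (hF : F ≠ 0)
    (U : Submodule ℂ (MvPolynomial (Fin 3) ℂ)) :
    Module.finrank ℂ (U.map (LinearMap.mulLeft ℂ F)) = Module.finrank ℂ U :=
  (Submodule.equivMapOfInjective _ (mulLeft_injective hF) U).finrank_eq.symm

/-- Exactness of the Koszul complex in degree m: the multiples of F₁ and those of F₂ span J_m, and
by coprimality they meet in the multiples of F₁F₂. -/
theorem finrank_intPart_span_pair {F₁ F₂ : MvPolynomial (Fin 3) ℂ} {a b : ℤ}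
    (h₁ : F₁ ∈ intForms a) (h₂ : F₂ ∈ intForms b) (h₁0 : F₁ ≠ 0) (h₂0 : F₂ ≠ 0)
    (hrel : IsRelPrime F₁ F₂) (m : ℤ) :
    Module.finrank ℂ (intPart (Ideal.span {F₁, F₂}) m) +
        Module.finrank ℂ (intForms (m - a - b)) =
      Module.finrank ℂ (intForms (m - a)) + Module.finrank ℂ (intForms (m - b)) := by
  have hsup : intPart (Ideal.span {F₁, F₂}) m = (intForms (m - a)).map (LinearMap.mulLeft ℂ F₁) ⊔
      (intForms (m - b)).map (LinearMap.mulLeft ℂ F₂) := by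
    apply le_antisymm
    · rintro p ⟨hp, hpm⟩
      obtain ⟨u, v, rfl⟩ := Ideal.mem_span_pair.mp hp
      rw [← intComponent_eq_self hpm, map_add, mul_comm u, mul_comm v, intComponent_mul h₁,
        intComponent_mul h₂]
      exact Submodule.add_mem_sup (Submodule.mem_map_of_mem (intComponent_mem _ _))
        (Submodule.mem_map_of_mem (intComponent_mem _ _))
    · rw [sup_le_iff]
      constructor
      · rintro _ ⟨p, hp, rfl⟩
        exact ⟨Ideal.mul_mem_right _ _ (Ideal.subset_span (by simp)), mul_mem_intForms h₁ hp⟩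
      · rintro _ ⟨p, hp, rfl⟩
        exact ⟨Ideal.mul_mem_right _ _ (Ideal.subset_span (by simp)), mul_mem_intForms h₂ hp⟩
  have hinf : (intForms (m - a)).map (LinearMap.mulLeft ℂ F₁) ⊓
      (intForms (m - b)).map (LinearMap.mulLeft ℂ F₂) =
      (intForms (m - a - b)).map (LinearMap.mulLeft ℂ (F₁ * F₂)) := by
    apply le_antisymm
    · rintro _ ⟨⟨p, hp, rfl⟩, ⟨q, hq, hpq⟩⟩
      simp only [LinearMap.mulLeft_apply] at hpq
      obtain ⟨c, rfl⟩ : F₂ ∣ p := hrel.symm.dvd_of_dvd_mul_left ⟨q, hpq.symm⟩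
      refine ⟨intComponent (m - a - b) c, intComponent_mem _ _, ?_⟩
      rw [LinearMap.mulLeft_apply, LinearMap.mulLeft_apply, mul_assoc, ← intComponent_mul h₂,
        intComponent_eq_self hp]
    · rintro _ ⟨p, hp, rfl⟩
      refine ⟨⟨F₂ * p, mul_mem_intForms h₂ hp, ?_⟩, ⟨F₁ * p, mul_mem_intForms h₁ ?_, ?_⟩⟩
      · simp
      · rwa [sub_right_comm]
      · simp only [LinearMap.mulLeft_apply]; ring
  have := Submodule.finrank_sup_add_finrank_inf_eq
    ((intForms (m - a)).map (LinearMap.mulLeft ℂ F₁))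
    ((intForms (m - b)).map (LinearMap.mulLeft ℂ F₂))
  rwa [← hsup, hinf, finrank_map_mulLeft h₁0, finrank_map_mulLeft h₂0,
    finrank_map_mulLeft (mul_ne_zero h₁0 h₂0)] at this

/-- Regularity of f modulo J gives f I_m ∩ J_{m+k} = f J_m, which says that f embeds I_m/J_m into
I_{m+k}/J_{m+k}. -/
theorem finrank_sup_add_finrank_intPart {I J : Ideal (MvPolynomial (Fin 3) ℂ)} (hJI : J ≤ I)
    {f : MvPolynomial (Fin 3) ℂ} {k : ℤ} (hf : f ∈ intForms k) (hf0 : f ≠ 0)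
    (hreg : ∀ p, f * p ∈ J → p ∈ J) (m : ℤ) :
    Module.finrank ℂ ↥((intPart I m).map (LinearMap.mulLeft ℂ f) ⊔ intPart J (m + k)) +
        Module.finrank ℂ (intPart J m) =
      Module.finrank ℂ (intPart I m) + Module.finrank ℂ (intPart J (m + k)) := by
  have hinf : (intPart I m).map (LinearMap.mulLeft ℂ f) ⊓ intPart J (m + k) =
      (intPart J m).map (LinearMap.mulLeft ℂ f) := by
    apply le_antisymm
    · rintro _ ⟨⟨p, hp, rfl⟩, hq⟩
      exact Submodule.mem_map_of_mem ⟨hreg p hq.1, hp.2⟩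
    · rintro _ ⟨p, hp, rfl⟩
      refine ⟨Submodule.mem_map_of_mem ⟨hJI hp.1, hp.2⟩, Ideal.mul_mem_left _ _ hp.1,
        mul_mem_intForms hf ?_⟩
      rw [add_sub_cancel_right]
      exact hp.2
  have := Submodule.finrank_sup_add_finrank_inf_eq
    ((intPart I m).map (LinearMap.mulLeft ℂ f)) (intPart J (m + k))
  rwa [hinf, finrank_map_mulLeft hf0, finrank_map_mulLeft hf0] at this

theorem sup_le_intPart {I J : Ideal (MvPolynomial (Fin 3) ℂ)} (hJI : J ≤ I)
    {f : MvPolynomial (Fin 3) ℂ} {k : ℤ} (hf : f ∈ intForms k) (m : ℤ) :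
    (intPart I m).map (LinearMap.mulLeft ℂ f) ⊔ intPart J (m + k) ≤ intPart I (m + k) := by
  rw [sup_le_iff]
  constructor
  · rintro _ ⟨p, hp, rfl⟩
    refine ⟨Ideal.mul_mem_left _ _ hp.1, mul_mem_intForms hf ?_⟩
    rw [add_sub_cancel_right]
    exact hp.2
  · exact inf_le_inf_right _ hJI

/-! ### A linear form that is regular modulo a complete intersection -/

/-- If `B` and `B'` are regular modulo `A` and lie in `m`, then `m`-torsion modulo `(A, B)` yields
`m`-torsion modulo `(A, B')`. -/
theorem exists_torsion_mod_pair_of_isRelPrime {R : Type*} [CommRing R] [IsDomain R]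
    [DecompositionMonoid R] {m : Ideal R} {A B B' : R} (hB' : B' ∈ m)
    (hAB : IsRelPrime A B) (hAB' : IsRelPrime A B')
    (h : ∃ g, g ∉ Ideal.span {A, B} ∧ ∀ w ∈ m, w * g ∈ Ideal.span {A, B}) :
    ∃ g, g ∉ Ideal.span {A, B'} ∧ ∀ w ∈ m, w * g ∈ Ideal.span {A, B'} := by
  obtain ⟨g, hg, htors⟩ := h
  obtain ⟨α, β, hαβ⟩ := Ideal.mem_span_pair.mp (htors B' hB')
  -- From B'g = αA + βB, the coefficient β is the new torsion element; cancelling B' modulo A shows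
  -- it is nonzero, and cancelling B modulo A shows it is torsion.
  refine ⟨β, fun hβ => hg ?_, fun w hw => ?_⟩
  · obtain ⟨γ, ε, rfl⟩ := Ideal.mem_span_pair.mp hβ
    obtain ⟨c, hc⟩ : A ∣ g - ε * B :=
      hAB'.dvd_of_dvd_mul_left ⟨α + γ * B, by linear_combination -hαβ⟩
    exact Ideal.mem_span_pair.mpr ⟨c, ε, by linear_combination -hc⟩
  · obtain ⟨α', β', hw'⟩ := Ideal.mem_span_pair.mp (htors w hw)
    obtain ⟨c, hc⟩ : A ∣ w * β - B' * β' :=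
      hAB.dvd_of_dvd_mul_left ⟨B' * α' - w * α, by linear_combination w * hαβ - B' * hw'⟩
    exact Ideal.mem_span_pair.mpr ⟨c, β', by linear_combination -hc⟩

theorem irreducible_X_add_C_mul_X (t : ℂ) :
    Irreducible (X 0 + C t * X 1 : MvPolynomial (Fin 3) ℂ) := by
  have hc : coeff (Finsupp.single 0 1) (X 0 + C t * X 1 : MvPolynomial (Fin 3) ℂ) = 1 := by
    simp [coeff_add, coeff_C_mul, coeff_X, Finsupp.single_left_inj]
  have hom : (X 0 + C t * X 1 : MvPolynomial (Fin 3) ℂ).IsHomogeneous 1 :=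
    (isHomogeneous_X ℂ 0).add (isHomogeneous_C_mul_X t 1)
  refine irreducible_of_totalDegree_eq_one (hom.totalDegree fun h => ?_) fun x hx => ?_
  · rw [h, coeff_zero] at hc
    exact zero_ne_one hc
  · have := hx (Finsupp.single 0 1)
    rw [hc] at this
    exact isUnit_of_dvd_one this

/-- The forms x + ty are pairwise coprime primes, and deg F + 1 of them cannot all divide F. -/
theorem exists_isRelPrime_X_add_C_mul_X {F : MvPolynomial (Fin 3) ℂ} (hF : F ≠ 0) :
    ∃ t : ℂ, IsRelPrime F (X 0 + C t * X 1) := by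
  by_contra! h
  have hdvd : ∀ t : ℂ, (X 0 + C t * X 1) ∣ F := fun t => by
    by_contra h'
    exact h t ((irreducible_X_add_C_mul_X t).isRelPrime_iff_not_dvd.mpr h').symm
  let s : Finset ℕ := Finset.range (F.totalDegree + 1)
  let q : ℕ → MvPolynomial (Fin 3) ℂ := fun i => X 0 + C (i : ℂ) * X 1
  have hpair : (s : Set ℕ).Pairwise (Function.onFun IsRelPrime q) := by
    intro i _ j _ hij
    refine (irreducible_X_add_C_mul_X i).isRelPrime_iff_not_dvd.mpr ?_
    rintro ⟨c, hc⟩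
    -- At the point (-i, 1, 0) the form x + iy vanishes while x + jy takes the value j - i.
    have := congrArg (eval ![-(i : ℂ), 1, 0]) hc
    simp only [q, map_add, map_mul, eval_X, eval_C, Matrix.cons_val_zero, Matrix.cons_val_one,
      mul_one, neg_add_cancel, zero_mul] at this
    have h2 : (j : ℂ) = i := by linear_combination this
    exact hij (Nat.cast_injective h2).symm
  have hprod : ∏ i ∈ s, q i ∣ F := Finset.prod_dvd_of_isRelPrime hpair fun i _ => hdvd i
  have hne : ∀ i ∈ s, q i ≠ 0 := fun i _ => (irreducible_X_add_C_mul_X i).ne_zero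
  have hdeg : (∏ i ∈ s, q i).totalDegree = F.totalDegree + 1 := by
    have hom : (∏ i ∈ s, q i).IsHomogeneous (∑ i ∈ s, 1) :=
      IsHomogeneous.prod s q _ fun i _ =>
        (isHomogeneous_X ℂ 0).add (isHomogeneous_C_mul_X (i : ℂ) 1)
    rw [hom.totalDegree (Finset.prod_ne_zero_iff.mpr hne)]
    simp [s]
  have := totalDegree_le_of_dvd_of_isDomain hprod hF
  omega

theorem isRelPrime_X_add_C_mul_X_X (t : ℂ) :
    IsRelPrime (X 0 + C t * X 1 : MvPolynomial (Fin 3) ℂ) (X 1) := by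
  refine ((X_prime.irreducible.isRelPrime_iff_not_dvd (n := X 0 + C t * X 1)).mpr
    fun h => ?_).symm
  rw [dvd_add_left (Dvd.intro_left _ rfl), X_dvd_X] at h
  exact absurd h (by decide)

/-- The irrelevant ideal is not an associated prime of a complete intersection of two polynomials. -/
theorem mem_span_pair_of_mul_X_mem {F₁ F₂ : MvPolynomial (Fin 3) ℂ} (h₁0 : F₁ ≠ 0)
    (hrel : IsRelPrime F₁ F₂) {g : MvPolynomial (Fin 3) ℂ}
    (hg : ∀ i, X i * g ∈ Ideal.span {F₁, F₂}) : g ∈ Ideal.span {F₁, F₂} := by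
  by_contra hgn
  have hX : ∀ i, (X i : MvPolynomial (Fin 3) ℂ) ∈ Ideal.span (Set.range X) := fun i =>
    Ideal.subset_span ⟨i, rfl⟩
  obtain ⟨t, ht⟩ := exists_isRelPrime_X_add_C_mul_X h₁0
  have hl : X 0 + C t * X 1 ∈ Ideal.span (Set.range (X : Fin 3 → MvPolynomial (Fin 3) ℂ)) :=
    add_mem (hX 0) (Ideal.mul_mem_left _ _ (hX 1))
  have htors : ∀ w ∈ Ideal.span (Set.range X), w * g ∈ Ideal.span {F₁, F₂} := by
    intro w hw
    induction hw using Submodule.span_induction with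
    | mem w hw => obtain ⟨i, rfl⟩ := hw; exact hg i
    | zero => simp
    | add u v _ _ hu hv => rw [add_mul]; exact add_mem hu hv
    | smul c u _ hu => rw [smul_eq_mul, mul_assoc]; exact Ideal.mul_mem_left _ _ hu
  -- Exchange generators one at a time, (F₁, F₂) to (F₁, x + ty) to (x + ty, y) = (x, y). There z is
  -- regular, so torsion is impossible.
  have step := exists_torsion_mod_pair_of_isRelPrime hl hrel ht ⟨g, hgn, htors⟩
  rw [Set.pair_comm] at step
  obtain ⟨β, hβ, hβt⟩ := exists_torsion_mod_pair_of_isRelPrime (hX 1) ht.symm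
    (isRelPrime_X_add_C_mul_X_X t) step
  have hspan : Ideal.span {X 0 + C t * X 1, X 1} =
      Ideal.span (X '' {0, 1} : Set (MvPolynomial (Fin 3) ℂ)) := by
    rw [Set.image_pair, Ideal.span_pair_add_mul_right]
  rw [hspan] at hβ hβt
  refine hβ ?_
  have h2 := hβt (X 2) (hX 2)
  rw [mem_ideal_span_X_image] at h2 ⊢
  intro d hd
  obtain ⟨i, hi, hid⟩ := h2 (Finsupp.single 2 1 + d) (by
    rw [mem_support_iff, coeff_X_mul]
    exact mem_support_iff.mp hd)
  refine ⟨i, hi, ?_⟩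
  rw [Finsupp.add_apply, Finsupp.single_apply, if_neg, zero_add] at hid
  · exact hid
  · rintro rfl
    simp at hi

/-- Prime avoidance in degree one: the linear forms in each of the finitely many associated primes
of S/J form a proper subspace, and finitely many such subspaces do not cover ℂ³. -/
theorem exists_linear_form_regular {F₁ F₂ : MvPolynomial (Fin 3) ℂ} (h₁0 : F₁ ≠ 0)
    (hrel : IsRelPrime F₁ F₂) :
    ∃ l : MvPolynomial (Fin 3) ℂ, l.IsHomogeneous 1 ∧ l ≠ 0 ∧
      ∀ p, l * p ∈ Ideal.span {F₁, F₂} → p ∈ Ideal.span {F₁, F₂} := by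
  classical
  set J : Ideal (MvPolynomial (Fin 3) ℂ) := Ideal.span {F₁, F₂} with hJ
  let M := MvPolynomial (Fin 3) ℂ ⧸ J
  let φ : (Fin 3 → ℂ) →ₗ[ℂ] MvPolynomial (Fin 3) ℂ :=
    ∑ i, (LinearMap.toSpanSingleton ℂ _ (X i)).comp (LinearMap.proj i)
  have hφ : ∀ c, φ c = ∑ i, c i • X i := fun c => by simp [φ]
  have hφs : ∀ i, φ (Pi.single i 1) = X i := fun i => by simp [hφ, Pi.single_apply]
  have hfin := associatedPrimes.finite (MvPolynomial (Fin 3) ℂ) M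
  -- Including the zero subspace forces the chosen form to be nonzero.
  let s : Finset (Submodule ℂ (Fin 3 → ℂ)) :=
    insert ⊥ (hfin.toFinset.image fun P => (P.restrictScalars ℂ).comap φ)
  have htop : ⊤ ∉ s := by
    intro h
    rcases Finset.mem_insert.mp h with h | h
    · exact top_ne_bot h
    · obtain ⟨P, hP, hPtop⟩ := Finset.mem_image.mp h
      rw [Set.Finite.mem_toFinset, AssociatedPrimes.mem_iff, isAssociatedPrime_iff] at hP
      obtain ⟨hprime, x, hx⟩ := hP
      obtain ⟨g, rfl⟩ := Ideal.Quotient.mk_surjective x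
      have hXP : ∀ i, X i ∈ P := fun i => by
        have : Pi.single i 1 ∈ (P.restrictScalars ℂ).comap φ := by rw [hPtop]; trivial
        rwa [Submodule.mem_comap, hφs] at this
      have hmem : ∀ w, w ∈ P ↔ w * g ∈ J := fun w => by
        rw [hx, Submodule.mem_colon_singleton, Submodule.mem_bot]
        exact Ideal.Quotient.eq_zero_iff_mem
      have hg := mem_span_pair_of_mul_X_mem h₁0 hrel (g := g)
        fun i => (hmem _).mp (hXP i)
      exact hprime.ne_top ((Ideal.eq_top_iff_one _).mpr ((hmem 1).mpr (by rwa [one_mul])))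
  obtain ⟨c, hc⟩ := (Set.ne_univ_iff_exists_notMem _).mp
    (Subspace.biUnion_ne_univ_of_top_notMem htop)
  have hc' : ∀ p ∈ s, c ∉ p := fun p hp h => hc (Set.mem_biUnion hp h)
  have hreg : ∀ p, φ c * p ∈ J → p ∈ J := by
    intro p hp
    by_contra hpJ
    have : φ c ∈ ⋃ P ∈ associatedPrimes (MvPolynomial (Fin 3) ℂ) M, (P : Set _) := by
      rw [biUnion_associatedPrimes_eq_zero_divisors]
      exact ⟨Ideal.Quotient.mk J p, fun h => hpJ (Ideal.Quotient.eq_zero_iff_mem.mp h),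
        Ideal.Quotient.eq_zero_iff_mem.mpr hp⟩
    obtain ⟨P, hP, hcP⟩ := Set.mem_iUnion₂.mp this
    exact hc' _ (Finset.mem_insert_of_mem (Finset.mem_image_of_mem _
      (hfin.mem_toFinset.mpr hP))) hcP
  refine ⟨φ c, ?_, ?_, hreg⟩
  · rw [hφ]
    exact IsHomogeneous.sum _ _ _ fun i _ => by
      rw [smul_eq_C_mul]
      exact isHomogeneous_C_mul_X _ _
  · intro h0
    refine hc' ⊥ (Finset.mem_insert_self _ _) ?_
    rw [Submodule.mem_bot]
    ext j
    have := congrArg (eval (Pi.single j (1 : ℂ))) h0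
    simpa [hφ, Pi.single_apply, smul_eq_C_mul] using this

/-! ### Hilbert functions and the degree of a finite subscheme -/

theorem finrank_quotientGrading_add
    (I : HomogeneousIdeal (homogeneousSubmodule (Fin 3) ℂ)) (n : ℕ) :
    Module.finrank ℂ (quotientGrading (homogeneousSubmodule (Fin 3) ℂ) I n) +
      Module.finrank ℂ (intPart I.toIdeal n) = Module.finrank ℂ (intForms n) := by
  let f := (Ideal.Quotient.mkₐ ℂ I.toIdeal).toLinearMap
  have hker : LinearMap.ker f = I.toIdeal.restrictScalars ℂ := by
    ext p
    exact Ideal.Quotient.eq_zero_iff_mem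
  have h := LinearMap.finrank_range_add_finrank_ker (f.domRestrict (intForms n))
  rw [LinearMap.range_domRestrict, LinearMap.ker_domRestrict, hker] at h
  have h2 : Module.finrank ℂ (((I.toIdeal.restrictScalars ℂ).comap (intForms n).subtype)) =
      Module.finrank ℂ (intPart I.toIdeal n) := by
    rw [intPart, inf_comm, ← Submodule.map_comap_subtype]
    exact (Submodule.equivMapOfInjective _ (intForms n).injective_subtype _).finrank_eq
  rw [h2, intForms_natCast] at h
  rw [intForms_natCast]
  exact h

variable {F₁ F₂ : MvPolynomial (Fin 3) ℂ} {a b : ℕ}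

/-- The bound m ≥ a + b - 2 keeps all degrees in the Koszul count at least -2, where dimensions are
given by polynomials; the difference is then identically ab. -/
theorem finrank_intForms_eq_finrank_intPart_add (h₁ : F₁ ∈ intForms a) (h₂ : F₂ ∈ intForms b)
    (h₁0 : F₁ ≠ 0) (h₂0 : F₂ ≠ 0) (hrel : IsRelPrime F₁ F₂) {m : ℤ} (hm : a + b - 2 ≤ m) :
    (Module.finrank ℂ (intForms m) : ℤ) =
      Module.finrank ℂ (intPart (Ideal.span {F₁, F₂}) m) + a * b := by
  have hk := finrank_intPart_span_pair h₁ h₂ h₁0 h₂0 hrel m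
  zify at hk
  have e0 := two_mul_finrank_intForms (m := m) (by omega)
  have e1 := two_mul_finrank_intForms (m := m - a) (by omega)
  have e2 := two_mul_finrank_intForms (m := m - b) (by omega)
  have e3 := two_mul_finrank_intForms (m := m - a - b) (by omega)
  linarith

/-- A homogeneous ideal containing a complete intersection of forms of degrees `a` and `b` defines a
finite scheme, of degree at most `a * b` minus the defect of the Hilbert functions. -/
theorem isFinite_and_finrank_add_finiteDegree_le
    (I : HomogeneousIdeal (homogeneousSubmodule (Fin 3) ℂ)) (h₁ : F₁ ∈ intForms a)
    (h₂ : F₂ ∈ intForms b) (h₁0 : F₁ ≠ 0) (h₂0 : F₂ ≠ 0) (hrel : IsRelPrime F₁ F₂)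
    (h₁I : F₁ ∈ I.toIdeal) (h₂I : F₂ ∈ I.toIdeal) :
    IsFinite (projSubschemeStructure (homogeneousSubmodule (Fin 3) ℂ) I) ∧
      ∀ m : ℤ, (Module.finrank ℂ (intPart I.toIdeal m) : ℤ) +
        finiteDegree (projSubschemeStructure (homogeneousSubmodule (Fin 3) ℂ) I) ≤
          Module.finrank ℂ (intPart (Ideal.span {F₁, F₂}) m) + a * b := by
  obtain ⟨l, hl, hl0, hreg⟩ := exists_linear_form_regular h₁0 hrel
  have hJI : Ideal.span {F₁, F₂} ≤ I.toIdeal := by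
    rw [Ideal.span_le]
    rintro _ (rfl | rfl)
    exacts [h₁I, h₂I]
  have hl' : l ∈ intForms (1 : ℕ) := by rwa [intForms_natCast]
  -- Multiplication by l is injective on S/J between two pieces of the same dimension ab, hence
  -- surjective.
  have hsurj : ∀ n : ℕ, a + b ≤ n →
      (intForms n).map (LinearMap.mulLeft ℂ l) ⊔ intPart (Ideal.span {F₁, F₂}) (n + (1 : ℕ)) =
        intForms (n + (1 : ℕ)) := by
    intro n hn
    have hle := sup_le_intPart (le_top : Ideal.span {F₁, F₂} ≤ ⊤) hl' n
    have hr := finrank_sup_add_finrank_intPart (le_top : Ideal.span {F₁, F₂} ≤ ⊤) hl' hl0 hreg n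
    rw [intPart_top, intPart_top] at hle
    rw [intPart_top] at hr
    have e0 := finrank_intForms_eq_finrank_intPart_add h₁ h₂ h₁0 h₂0 hrel (m := n) (by omega)
    have e1 := finrank_intForms_eq_finrank_intPart_add h₁ h₂ h₁0 h₂0 hrel
      (m := n + (1 : ℕ)) (by omega)
    exact Submodule.eq_of_le_of_finrank_le hle (by omega)
  let q := Ideal.Quotient.mkₐ ℂ I.toIdeal
  have hlq : q l ∈ quotientGrading (homogeneousSubmodule (Fin 3) ℂ) I 1 := ⟨l, hl, rfl⟩
  have hmul : ∀ n, a + b ≤ n → ∀ c ∈ quotientGrading (homogeneousSubmodule (Fin 3) ℂ) I (n + 1),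
      ∃ c' ∈ quotientGrading (homogeneousSubmodule (Fin 3) ℂ) I n, c = q l * c' := by
    rintro n hn _ ⟨p, hp, rfl⟩
    have hp' : p ∈ intForms (n + (1 : ℕ)) := by
      rw [← Nat.cast_add, intForms_natCast]
      exact hp
    rw [← hsurj n hn] at hp'
    obtain ⟨_, ⟨r, hr, rfl⟩, j, hj, rfl⟩ := Submodule.mem_sup.mp hp'
    rw [SetLike.mem_coe, intForms_natCast] at hr
    refine ⟨q r, ⟨r, hr, rfl⟩, ?_⟩
    have hqj : q j = 0 := Ideal.Quotient.eq_zero_iff_mem.mpr (hJI hj.1)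
    change q (l * r + j) = _
    rw [map_add, map_mul, hqj, add_zero]
  have hfin : ∀ n, Module.Finite ℂ (quotientGrading (homogeneousSubmodule (Fin 3) ℂ) I n) := by
    intro n
    have : Module.Finite ℂ (homogeneousSubmodule (Fin 3) ℂ n) := by
      rw [← intForms_natCast]
      infer_instance
    exact Module.Finite.map _ _
  have hproj : ∀ N, a + b ≤ N →
      IsFinite (projSubschemeStructure (homogeneousSubmodule (Fin 3) ℂ) I) ∧
        finiteDegree (projSubschemeStructure (homogeneousSubmodule (Fin 3) ℂ) I) ≤
          Module.finrank ℂ (quotientGrading (homogeneousSubmodule (Fin 3) ℂ) I N) :=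
    fun N hN => isFinite_projStructure_and_finiteDegree_le hlq hmul hfin hN
  refine ⟨(hproj _ le_rfl).1, fun m => ?_⟩
  obtain ⟨k, N, hk, hN⟩ : ∃ k N : ℕ, m + k = N ∧ a + b ≤ N :=
    ⟨(a + b - m).toNat, (m + (a + b - m).toNat).toNat, by omega, by omega⟩
  have hlk : l ^ k ∈ intForms k := by
    rw [intForms_natCast]
    simpa using hl.pow k
  have hregk : ∀ k p, l ^ k * p ∈ Ideal.span {F₁, F₂} → p ∈ Ideal.span {F₁, F₂} := by
    intro k
    induction k with
    | zero => simp
    | succ k ih => exact fun p hp => ih p (hreg _ (by rwa [← mul_assoc, ← pow_succ']))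
  -- This yields dim I_m - dim J_m ≤ dim I_N - dim J_N, and the right side equals ab - dim (S/I)_N ≤
  -- ab - deg X.
  have hr := finrank_sup_add_finrank_intPart hJI hlk (pow_ne_zero k hl0) (hregk k) m
  have hle := Submodule.finrank_mono (sup_le_intPart hJI hlk m)
  rw [hk] at hr hle
  have e := finrank_intForms_eq_finrank_intPart_add h₁ h₂ h₁0 h₂0 hrel (m := N) (by omega)
  have e2 := finrank_quotientGrading_add I N
  have e3 := (hproj N hN).2
  zify at hr hle e2 e3
  linarith

/-! ### The space of integral forms -/

theorem predForms_eq (d : ℕ) : predForms d = intForms (d - 1) := by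
  rcases d with _ | d
  · rw [intForms_of_neg (by simp)]
    rfl
  · rw [Nat.cast_succ, add_sub_cancel_right, intForms_natCast]
    rfl

/-- Rank-nullity for (u, v, w) ↦ C_x u + C_y v + C w. Integer degrees cover d = 0 and e = 0
uniformly, where d - 1, e - 1 or d + e - 1 can be -1. -/
theorem le_finrank_integralForms (C : MvPolynomial (Fin 3) ℂ) {e : ℕ} (hC : C.IsHomogeneous e)
    (he : pderiv 0 C ∈ intForms (e - 1)) (he' : pderiv 1 C ∈ intForms (e - 1)) (d : ℕ) :
    2 * Module.finrank ℂ (intForms d) + Module.finrank ℂ (intForms (d - 1)) ≤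
      Module.finrank ℂ (integralForms C d) +
        Module.finrank ℂ (intPart (darbouxIdeal C hC).toIdeal (d + e - 1)) := by
  let V : Fin 3 → Submodule ℂ (MvPolynomial (Fin 3) ℂ) :=
    ![homogeneousSubmodule (Fin 3) ℂ d, homogeneousSubmodule (Fin 3) ℂ d, predForms d]
  have hV : ∀ i, V i = ![intForms d, intForms d, intForms (d - 1)] i := by
    intro i
    fin_cases i
    · exact (intForms_natCast d).symm
    · exact (intForms_natCast d).symm
    · exact predForms_eq d
  have hVfin : ∀ i, Module.Finite ℂ (V i) := by
    intro i
    rw [hV]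
    fin_cases i <;> exact finite_intForms _
  let W := Submodule.pi Set.univ V
  let E : W ≃ₗ[ℂ] (∀ i, V i) :=
    { toFun := fun w i => ⟨w.1 i, w.2 i trivial⟩
      invFun := fun w => ⟨fun i => w i, fun i _ => (w i).2⟩
      map_add' := fun _ _ => rfl
      map_smul' := fun _ _ => rfl
      left_inv := fun _ => rfl
      right_inv := fun _ => rfl }
  have hWfin : Module.Finite ℂ W := Module.Finite.equiv E.symm
  have hW : Module.finrank ℂ W =
      2 * Module.finrank ℂ (intForms d) + Module.finrank ℂ (intForms (d - 1)) := by
    rw [E.finrank_eq, Module.finrank_pi_fintype, Fin.sum_univ_three, hV, hV, hV, two_mul]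
    rfl
  let I := (darbouxIdeal C hC).toIdeal
  have hI : ∀ j, darbouxMatrix C 0 j ∈ I := fun j => Ideal.subset_span ⟨j, rfl⟩
  let φ : (Fin 3 → MvPolynomial (Fin 3) ℂ) →ₗ[ℂ] MvPolynomial (Fin 3) ℂ :=
    (LinearMap.proj 0 ∘ₗ (darbouxMatrix C).mulVecLin).restrictScalars ℂ
  have hφ : ∀ w, φ w = pderiv 0 C * w 0 + pderiv 1 C * w 1 + C * w 2 := by
    intro w
    simp [φ, Matrix.mulVec, dotProduct, Fin.sum_univ_three, darbouxMatrix]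
  have hker : (LinearMap.ker (darbouxMatrix C).mulVecLin).restrictScalars ℂ = LinearMap.ker φ := by
    ext w
    simp only [Submodule.restrictScalars_mem, LinearMap.mem_ker]
    exact ⟨fun h => congrFun h 0, fun h => funext fun i => by rw [Subsingleton.elim i 0]; exact h⟩
  have hrange : LinearMap.range (φ.domRestrict W) ≤ intPart I (d + e - 1) := by
    rintro _ ⟨⟨w, hw⟩, rfl⟩
    have hw' : ∀ i, w i ∈ ![intForms d, intForms d, intForms (d - 1)] i := fun i => by
      rw [← hV]
      exact hw i trivial
    have hC' : C ∈ intForms e := by rwa [intForms_natCast]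
    rw [LinearMap.domRestrict_apply, hφ]
    refine ⟨add_mem (add_mem ?_ ?_) ?_, add_mem (add_mem ?_ ?_) ?_⟩
    · exact Ideal.mul_mem_right _ _ (hI 0)
    · exact Ideal.mul_mem_right _ _ (hI 1)
    · exact Ideal.mul_mem_right _ _ (hI 2)
    · refine mul_mem_intForms he ?_
      rw [show (d + e - 1 : ℤ) - (e - 1) = d by ring]
      exact hw' 0
    · refine mul_mem_intForms he' ?_
      rw [show (d + e - 1 : ℤ) - (e - 1) = d by ring]
      exact hw' 1
    · refine mul_mem_intForms hC' ?_
      rw [show (d + e - 1 : ℤ) - e = d - 1 by ring]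
      exact hw' 2
  have hdim := LinearMap.finrank_range_add_finrank_ker (φ.domRestrict W)
  have hk : Module.finrank ℂ (LinearMap.ker (φ.domRestrict W)) =
      Module.finrank ℂ (integralForms C d) := by
    rw [LinearMap.ker_domRestrict, integralForms, hker, inf_comm, ← Submodule.map_comap_subtype]
    exact (Submodule.equivMapOfInjective _ W.injective_subtype _).finrank_eq
  have hle : _ ≤ Module.finrank ℂ (intPart (darbouxIdeal C hC).toIdeal _) :=
    Submodule.finrank_mono hrange
  omega

/-! ### Common components of the generators of the Darboux ideal -/

/-- A nonzero partial derivative has smaller degree than P, so all of them vanish; in characteristic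
zero P is then constant. -/
theorem eq_C_of_dvd_pderiv {P : MvPolynomial (Fin 3) ℂ} (h : ∀ i, P ∣ pderiv i P) :
    P = C (coeff 0 P) := by
  have hz : ∀ i, pderiv i P = 0 := by
    intro i
    by_contra hne
    have hP : P ≠ 0 := fun h0 => hne (by rw [h0, map_zero])
    have hdeg : ∀ d ∈ (pderiv i P).support, d.degree + 1 ≤ P.totalDegree := by
      intro d hd
      rw [mem_support_iff, coeff_pderiv] at hd
      have := le_totalDegree (mem_support_iff.mpr (left_ne_zero_of_mul hd))
      change (d + Finsupp.single i 1).degree ≤ _ at this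
      rwa [map_add, Finsupp.degree_single] at this
    obtain ⟨d₀, hd₀⟩ := support_nonempty.mpr hne
    have h₀ := hdeg d₀ hd₀
    have hle : (pderiv i P).totalDegree ≤ P.totalDegree - 1 :=
      Finset.sup_le fun d hd => by
        have := hdeg d hd
        change d.degree ≤ _
        omega
    have := totalDegree_le_of_dvd_of_isDomain (h i) hne
    omega
  ext d
  rw [coeff_C]
  split_ifs with hd
  · rw [hd]
  · obtain ⟨i, hi⟩ : ∃ i, d i ≠ 0 := by
      by_contra! h0
      exact hd (Finsupp.ext h0).symm
    have h1 := congrArg (coeff (d - Finsupp.single i 1)) (hz i)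
    rw [coeff_pderiv, coeff_zero, tsub_add_cancel_of_le
      (Finsupp.single_le_iff.mpr (Nat.one_le_iff_ne_zero.mpr hi))] at h1
    exact (mul_eq_zero.mp h1).resolve_right (Nat.cast_add_one_ne_zero _)

/-- An irreducible polynomial does not divide a reduced curve without component at infinity and both
its partial derivatives. -/
theorem not_dvd_pderiv {C P : MvPolynomial (Fin 3) ℂ} {e : ℕ} (hC : C.IsHomogeneous e)
    (hred : Squarefree C) (hinf : ¬ (X 2 : MvPolynomial (Fin 3) ℂ) ∣ C) (hP : Irreducible P)
    (h : P ∣ C) (h0 : P ∣ pderiv 0 C) (h1 : P ∣ pderiv 1 C) : False := by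
  have hprime : Prime P := hP.prime
  -- Euler's relation gives P ∣ z C_z, and P is not associated to z because z ∤ C.
  have h2 : P ∣ pderiv 2 C := by
    have heuler := hC.sum_X_mul_pderiv
    rw [Fin.sum_univ_three] at heuler
    have hdvd : P ∣ X 2 * pderiv 2 C := by
      rw [← dvd_add_right (dvd_add (h0.mul_left (X 0)) (h1.mul_left (X 1))), heuler]
      rw [nsmul_eq_mul]
      exact h.mul_left _
    refine (hprime.dvd_or_dvd hdvd).resolve_left fun hX => hinf ?_
    exact ((hP.associated_of_dvd X_prime.irreducible hX).symm.dvd).trans h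
  have hall : ∀ i, P ∣ pderiv i C := by
    intro i
    fin_cases i
    exacts [h0, h1, h2]
  obtain ⟨Q, rfl⟩ := h
  -- Since C = PQ is squarefree, Leibniz's rule now forces P to divide its own derivatives.
  have hPQ : ¬ P ∣ Q := fun ⟨c, hc⟩ => hP.not_isUnit (hred P ⟨c, by rw [hc, mul_assoc]⟩)
  have hd : ∀ i, P ∣ pderiv i P := by
    intro i
    have := hall i
    rw [Derivation.leibniz, smul_eq_mul, smul_eq_mul, dvd_add_right (Dvd.intro _ rfl)] at this
    exact (hprime.dvd_or_dvd this).resolve_left hPQ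
  have hc := eq_C_of_dvd_pderiv hd
  refine hP.not_isUnit ?_
  rw [hc]
  refine (isUnit_iff_ne_zero.mpr fun h0 => hP.ne_zero ?_).map C
  rw [hc, h0, C_0]

theorem dvd_of_dvd_X_mul {P f : MvPolynomial (Fin 3) ℂ} (hP : Prime P) (h0 : P ∣ X 0 * f)
    (h1 : P ∣ X 1 * f) : P ∣ f := by
  by_contra hf
  have h0' := (hP.dvd_or_dvd h0).resolve_right hf
  have h1' := (hP.dvd_or_dvd h1).resolve_right hf
  have := ((hP.irreducible.associated_of_dvd X_prime.irreducible h0').symm.dvd).trans h1'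
  rw [X_dvd_X] at this
  exact absurd this (by decide)

theorem pderiv_mem_intForms {C : MvPolynomial (Fin 3) ℂ} {e : ℕ} (hC : C.IsHomogeneous e)
    (i : Fin 3) : pderiv i C ∈ intForms (e - 1) := by
  rcases e with _ | e
  · rw [← totalDegree_zero_iff_isHomogeneous, totalDegree_eq_zero_iff_eq_C] at hC
    rw [hC, pderiv_C]
    exact zero_mem _
  · rw [Nat.cast_succ, add_sub_cancel_right, intForms_natCast]
    exact hC.pderiv

/-- The Darboux ideal of a reduced curve of degree `e` without component at infinity contains a form
of degree `e` coprime to any given nonzero polynomial. -/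
theorem exists_mem_darbouxIdeal_isRelPrime {C : MvPolynomial (Fin 3) ℂ} {e : ℕ}
    (hC : C.IsHomogeneous e) (hred : Squarefree C)
    (hinf : ¬ (X 2 : MvPolynomial (Fin 3) ℂ) ∣ C) {F : MvPolynomial (Fin 3) ℂ} (hF : F ≠ 0) :
    ∃ G ∈ intPart (darbouxIdeal C hC).toIdeal e, G ≠ 0 ∧ IsRelPrime F G := by
  classical
  let E := intPart (darbouxIdeal C hC).toIdeal e
  have hI : ∀ j, darbouxMatrix C 0 j ∈ (darbouxIdeal C hC).toIdeal := fun j =>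
    Ideal.subset_span ⟨j, rfl⟩
  have hX : ∀ i, (X i : MvPolynomial (Fin 3) ℂ) ∈ intForms (1 : ℕ) := fun i => by
    rw [intForms_natCast]
    exact isHomogeneous_X ℂ i
  have hCE : C ∈ E := ⟨hI 2, by rwa [intForms_natCast]⟩
  have h0E : ∀ i, X i * pderiv 0 C ∈ E := fun i =>
    ⟨Ideal.mul_mem_left _ _ (hI 0), mul_mem_intForms (hX i) (pderiv_mem_intForms hC 0)⟩
  have h1E : ∀ i, X i * pderiv 1 C ∈ E := fun i =>
    ⟨Ideal.mul_mem_left _ _ (hI 1), mul_mem_intForms (hX i) (pderiv_mem_intForms hC 1)⟩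
  -- A general G in I_e avoids zero and the multiples of each irreducible factor P of F. These
  -- subspaces are proper: if P divided C and the products of x, y with C_x, C_y, it would divide C,
  -- C_x and C_y.
  let s : Finset (Submodule ℂ E) :=
    insert ⊥ ((UniqueFactorizationMonoid.factors F).toFinset.image fun P =>
      ((Ideal.span {P}).restrictScalars ℂ).comap E.subtype)
  have htop : ⊤ ∉ s := by
    intro h
    rcases Finset.mem_insert.mp h with h | h
    · have : (⟨C, hCE⟩ : E) ∈ (⊥ : Submodule ℂ E) := h ▸ Submodule.mem_top
      exact hred.ne_zero (congrArg Subtype.val ((Submodule.mem_bot ℂ).mp this))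
    · obtain ⟨P, hP, hPtop⟩ := Finset.mem_image.mp h
      have hirr := UniqueFactorizationMonoid.irreducible_of_factor P (Multiset.mem_toFinset.mp hP)
      have hdvd : ∀ f ∈ E, P ∣ f := fun f hf => by
        have : (⟨f, hf⟩ : E) ∈ ((Ideal.span {P}).restrictScalars ℂ).comap E.subtype :=
          hPtop ▸ Submodule.mem_top
        exact Ideal.mem_span_singleton.mp this
      exact not_dvd_pderiv hC hred hinf hirr (hdvd C hCE)
        (dvd_of_dvd_X_mul hirr.prime (hdvd _ (h0E 0)) (hdvd _ (h0E 1)))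
        (dvd_of_dvd_X_mul hirr.prime (hdvd _ (h1E 0)) (hdvd _ (h1E 1)))
  obtain ⟨G, hG⟩ := (Set.ne_univ_iff_exists_notMem _).mp
    (Subspace.biUnion_ne_univ_of_top_notMem htop)
  have hG' : ∀ p ∈ s, G ∉ p := fun p hp h => hG (Set.mem_biUnion hp h)
  refine ⟨G, G.2, fun h => hG' ⊥ (Finset.mem_insert_self _ _) ?_, ?_⟩
  · rw [Submodule.mem_bot]
    exact Subtype.ext h
  · refine (UniqueFactorizationMonoid.isRelPrime_iff_no_prime_factors hF).mpr
      fun {q} hqF hqG hq => ?_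
    obtain ⟨P, hP, hqP⟩ := UniqueFactorizationMonoid.exists_mem_factors_of_dvd hF hq.irreducible hqF
    exact hG' _ (Finset.mem_insert_of_mem (Finset.mem_image_of_mem _
      (Multiset.mem_toFinset.mpr hP))) (Ideal.mem_span_singleton.mpr (hqP.symm.dvd.trans hqG))

theorem pderiv_ne_zero_or {C : MvPolynomial (Fin 3) ℂ} {e : ℕ} (hC : C.IsHomogeneous e)
    (he : e ≠ 0) (hred : Squarefree C) (hinf : ¬ (X 2 : MvPolynomial (Fin 3) ℂ) ∣ C) :
    pderiv 0 C ≠ 0 ∨ pderiv 1 C ≠ 0 := by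
  by_contra! h
  have hunit : ¬ IsUnit C := fun hu => by
    have := (isUnit_iff_totalDegree_of_isReduced.mp hu).2
    rw [hC.totalDegree hred.ne_zero] at this
    exact he this
  obtain ⟨P, hP, hPC⟩ := WfDvdMonoid.exists_irreducible_factor hunit hred.ne_zero
  exact not_dvd_pderiv hC hred hinf hP hPC (h.1 ▸ dvd_zero P) (h.2 ▸ dvd_zero P)

theorem not_isUnit_pderiv {C : MvPolynomial (Fin 3) ℂ} {e : ℕ} (hC : C.IsHomogeneous e)
    (he : 2 ≤ e) (i : Fin 3) : ¬ IsUnit (pderiv i C) := fun hu => by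
  have := (isUnit_iff_totalDegree_of_isReduced.mp hu).2
  rw [hC.pderiv.totalDegree hu.ne_zero] at this
  omega

end PlaneCurve

/-! ### The lower bound -/

open PlaneCurve in
theorem proposition4p10 (e d : ℕ) (C : MvPolynomial (Fin 3) ℂ) (hC : C.IsHomogeneous e)
    (hred : Squarefree C) (hinf : ¬ (X 2 : MvPolynomial (Fin 3) ℂ) ∣ C)
    (hW : d + 2 < e → IsRelPrime (pderiv 0 C) (pderiv 1 C)) :
    IsFinite (PlaneCurve.darbouxScheme C hC) ∧
    ((if e ≤ d + 1 then (d + 3 - e).choose 2 else 0 : ℕ) : ℤ) + ((d + 1).choose 2 : ℤ)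
        - ((e : ℤ) - 1) ^ 2 + (PlaneCurve.finiteDegree (PlaneCurve.darbouxScheme C hC) : ℤ)
      ≤ (Module.finrank ℂ (PlaneCurve.integralForms C d) : ℤ) := by
  have hI : ∀ j, darbouxMatrix C 0 j ∈ (darbouxIdeal C hC).toIdeal := fun j =>
    Ideal.subset_span ⟨j, rfl⟩
  have hV := le_finrank_integralForms C hC (pderiv_mem_intForms hC 0) (pderiv_mem_intForms hC 1) d
  zify at hV
  have s0 := two_mul_finrank_intForms (m := d) (by omega)
  have s1 := two_mul_finrank_intForms (m := d - 1) (by omega)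
  have c1 := two_mul_choose_two (d + 1)
  have c2 : e ≤ d + 3 → 2 * (((d + 3 - e).choose 2 : ℕ) : ℤ) = (d + 3 - e) * (d + 2 - e) := by
    intro h
    rw [two_mul_choose_two, Nat.cast_sub h]
    push_cast
    ring
  push_cast at c1
  rcases Nat.eq_zero_or_pos e with rfl | he
  · have htop : (darbouxIdeal C hC).toIdeal = ⊤ := by
      have hconst := hC
      rw [← totalDegree_zero_iff_isHomogeneous, totalDegree_eq_zero_iff_eq_C] at hconst
      refine Ideal.eq_top_of_isUnit_mem _ (hI 2) ?_
      change IsUnit C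
      rw [hconst]
      refine (isUnit_iff_ne_zero.mpr fun h => hred.ne_zero ?_).map MvPolynomial.C
      rw [hconst, h, C_0]
    have h1 : (1 : MvPolynomial (Fin 3) ℂ) ∈ intForms (0 : ℕ) := by
      rw [intForms_natCast]
      exact isHomogeneous_one _ _
    have h1I : (1 : MvPolynomial (Fin 3) ℂ) ∈ (darbouxIdeal C hC).toIdeal := htop ▸ trivial
    -- The pair (1, 1) serves as a complete intersection of degrees 0, 0, so deg X ≤ 0.
    obtain ⟨hfin, hle⟩ := isFinite_and_finrank_add_finiteDegree_le (darbouxIdeal C hC) h1 h1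
      one_ne_zero one_ne_zero isRelPrime_one_left h1I h1I
    refine ⟨hfin, ?_⟩
    have hle := hle (d - 1)
    have hspan : Ideal.span {1, (1 : MvPolynomial (Fin 3) ℂ)} = ⊤ :=
      (Ideal.eq_top_iff_one _).mpr (Ideal.subset_span (by simp))
    have c2 := c2 (by omega)
    rw [htop, hspan] at hle
    rw [htop, intPart_top, Nat.cast_zero, add_zero] at hV
    rw [if_pos (by omega), darbouxScheme]
    push_cast at *
    simp only [add_zero, sub_zero] at *
    linarith
  · rcases lt_or_ge (d + 2) e with hde | hde
    · have hrel := hW hde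
      have hne0 : pderiv 0 C ≠ 0 := fun h => by
        rw [h, isRelPrime_zero_left] at hrel
        exact not_isUnit_pderiv hC (by omega) 1 hrel
      have hne1 : pderiv 1 C ≠ 0 := fun h => by
        rw [h, isRelPrime_zero_right] at hrel
        exact not_isUnit_pderiv hC (by omega) 0 hrel
      obtain ⟨a, rfl⟩ : ∃ a, e = a + 1 := ⟨e - 1, by omega⟩
      have hm := fun i => pderiv_mem_intForms hC i
      simp only [Nat.cast_succ, add_sub_cancel_right] at hm
      obtain ⟨hfin, hle⟩ := isFinite_and_finrank_add_finiteDegree_le (darbouxIdeal C hC) (hm 0)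
        (hm 1) hne0 hne1 hrel (hI 0) (hI 1)
      refine ⟨hfin, ?_⟩
      have hle := hle (d + (a + 1 : ℕ) - 1)
      have hk := finrank_intPart_span_pair (hm 0) (hm 1) hne0 hne1 hrel (d + (a + 1 : ℕ) - 1)
      -- The Koszul syzygies would have degree d - e + 1 < 0, so dim J_m = 2 dim S_d.
      have hneg : Module.finrank ℂ (intForms (d + (a + 1 : ℕ) - 1 - a - a)) = 0 := by
        rw [intForms_of_neg (by omega), finrank_bot]
      rw [hneg, show (d + (a + 1 : ℕ) - 1 - a : ℤ) = d by push_cast; ring] at hk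
      zify at hk
      rw [if_neg (by omega), darbouxScheme]
      push_cast at *
      linarith
    · obtain ⟨F, hFmem, hF0, hFI⟩ : ∃ F ∈ intForms (e - 1), F ≠ 0 ∧
          F ∈ (darbouxIdeal C hC).toIdeal := by
        rcases pderiv_ne_zero_or hC he.ne' hred hinf with h | h
        exacts [⟨_, pderiv_mem_intForms hC 0, h, hI 0⟩, ⟨_, pderiv_mem_intForms hC 1, h, hI 1⟩]
      obtain ⟨G, ⟨hGI, hGmem⟩, hG0, hrel⟩ :=
        exists_mem_darbouxIdeal_isRelPrime hC hred hinf hF0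
      obtain ⟨a, rfl⟩ : ∃ a, e = a + 1 := ⟨e - 1, by omega⟩
      simp only [Nat.cast_succ, add_sub_cancel_right] at hFmem
      obtain ⟨hfin, hle⟩ := isFinite_and_finrank_add_finiteDegree_le (darbouxIdeal C hC) hFmem
        hGmem hF0 hG0 hrel hFI hGI
      refine ⟨hfin, ?_⟩
      have hle := hle (d + (a + 1 : ℕ) - 1)
      have hk := finrank_intForms_eq_finrank_intPart_add hFmem hGmem hF0 hG0 hrel
        (m := d + (a + 1 : ℕ) - 1) (by omega)
      have s2 := two_mul_finrank_intForms (m := d + (a + 1 : ℕ) - 1) (by omega)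
      have c2 := c2 (by omega)
      -- In the boundary case e = d + 2 the binomial is 1 choose 2 = 0, in agreement with the
      -- convention.
      have hif : ((if a + 1 ≤ d + 1 then (d + 3 - (a + 1)).choose 2 else 0 : ℕ) : ℤ) =
          ((d + 3 - (a + 1)).choose 2 : ℕ) := by
        split_ifs
        · rfl
        · rw [Nat.choose_eq_zero_of_lt (by omega)]
      rw [hif, darbouxScheme]
      push_cast at *
      linarith

end
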